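/- **Conventions.** A $3$-graph $H$ consists of a finite vertex set $V(H)$ and a set $E(H)$ of $3$-element subsets of $V(H)$. It is tripartite, written $H=(U\cup V\cup W,F)$, if $V(H)$ is the disjoint union of $U,V,W$, $F=E(H)$, and every edge meets each of $U,V,W$ in at most one vertex. The slice graph $H_x$ at $x\in V(H)$ is the graph on $V(H)$ whose edges are the pairs $yz$ with $xyz\in E(H)$. The VC-dimension of a graph $G$ is the largest $d$ for which there are vertices $a_i$ $(i\in[d])$ and $b_S$ $(S\subseteq[d])$ of $G$ such that $a_ib_S\in E(G)$ if and only if $i\in S$; the slicewise VC-dimension of $H$ is the maximum of the VC-dimensions of the graphs $H_x$, $x\in V(H)$. Partitions are into nonempty parts, and the size of a partition is its number of parts. Let $\epsilon>0$. For nonempty $X,Y,Z\subseteq V(H)$ put $$d_H(X,Y,Z)=\frac{|\{(x,y,z)\in X\times Y\times Z:\ xyz\in E(H)\}|}{|X||Y||Z|},$$ and call $(X,Y,Z)$ $\epsilon$-homogeneous if $d_H(X,Y,Z)\in[0,\epsilon)\cup(1-\epsilon,1]$. A partition $\mathcal P$ of $V(H)$ is $\epsilon$-homogeneous with respect to $H$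 if at least $(1-\epsilon)|V(H)|^3$ of the triples $(x,y,z)\in V(H)^3$ lie in $X\times Y\times Z$ for some $\epsilon$-homogeneous $(X,Y,Z)\in\mathcal P^3$. Let $H$ be tripartite and let $A,B,C$ be its three parts in any order. A nonempty set $X\subseteq A$ is almost $\epsilon$-good with respect to $H$ if for at least $(1-\epsilon)|B||C|$ pairs $(y,z)\in B\times C$ one has $$\frac{|\{x\in X:\ xyz\in E(H)\}|}{|X|}\in[0,\epsilon)\cup(1-\epsilon,1].$$ A partition $\mathcal P$ of $A$ is almost $\epsilon$-good with respect to $H$ if there is $\mathcal P'\subseteq\mathcal P$ such that $\left|\bigcup_{X\in\mathcal P'}X\right|\ge(1-\epsilon)|A|$ and every $X\in\mathcal P'$ is almost $\epsilon$-good with respect to $H$. **Theorem 4.1.** For every integer $k\ge1$ there are real numbers $K,\epsilon^*>0$ such that for every real $\tau$ with $0<\tau<\epsilon^*$ there is an integer $n_0$ such that the following holds. Let $H=(U\cup V\cup W,F)$ be a tripartite $3$-graph with $|U|=|V|=|W|$, with $|V(H)|\ge n_0$, and with slicewise VC-dimension less than $k$. Then there exists a $\tau$-homogeneous partition $\mathcal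 P$ of $V(H)$ with respect to $H$ of size at most $2^{2^{\tau^{-K}}}$. Moreover, $\mathcal P$ can be chosen of the form $\mathcal P=\mathcal P_U\cup\mathcal P_V\cup\mathcal P_W$, where $\mathcal P_U,\mathcal P_V,\mathcal P_W$ are almost $(\tau^{64}/28)$-good partitions, with respect to $H$, of $U$, $V$, $W$ respectively. -/

import Mathlib

open scoped Hypergraph

namespace Hypergraph

variable {α : Type*}

/-- A `k`-uniform hypergraph: every edge is a set of exactly `k` vertices. For `k = 3` this is a
`3`-graph, for `k = 2` a graph. -/
def IsUniform (H : Hypergraph α) (k : ℕ) : Prop :=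
  ∀ e ∈ E(H), e.encard = k

/-- `H` is tripartite with parts `U`, `V`, `W`: the vertex set is the disjoint union of the three
finite sets `U`, `V`, `W`, and every edge meets each of them in at most one vertex. -/
structure IsTripartite (H : Hypergraph α) (U V W : Finset α) : Prop where
  vertexSet_eq : V(H) = (U : Set α) ∪ (V : Set α) ∪ (W : Set α)
  disjoint_left_mid : Disjoint U V
  disjoint_left_right : Disjoint U W
  disjoint_mid_right : Disjoint V W
  encard_inter_left_le : ∀ e ∈ E(H), (e ∩ (U : Set α)).encard ≤ 1
  encard_inter_mid_le : ∀ e ∈ E(H), (e ∩ (V : Set α)).encard ≤ 1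
  encard_inter_right_le : ∀ e ∈ E(H), (e ∩ (W : Set α)).encard ≤ 1

/-- The slice graph of `H` at `x`: its vertex set is the whole vertex set of `H`, its edges are the
pairs of vertices that together with `x` form an edge of `H`.  If `H` is a `3`-graph, no pair
containing `x` is an edge of the slice graph. -/
def sliceGraph (H : Hypergraph α) (x : α) : Hypergraph α where
  vertexSet := V(H)
  edgeSet := {e | e ⊆ V(H) ∧ e.encard = 2 ∧ insert x e ∈ E(H)}
  subset_vertexSet_of_mem_edgeSet' := fun _ he => he.1

/-- There are vertices `a i` (for `i ∈ [k]`) and `b S` (for `S ⊆ [k]`) of the graph `G` such that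
`{a i, b S}` is an edge of `G` if and only if `i ∈ S`. -/
def ShattersSize (G : Hypergraph α) (k : ℕ) : Prop :=
  ∃ (a : Fin k → α) (b : Finset (Fin k) → α),
    (∀ i, a i ∈ V(G)) ∧ (∀ S, b S ∈ V(G)) ∧ ∀ i S, ({a i, b S} : Set α) ∈ E(G) ↔ i ∈ S

/-- The VC-dimension of a graph: the largest `k` with `G.ShattersSize k` (and `⊤` if there are
arbitrarily large ones, which is impossible for finite `G`). -/
noncomputable def vcDim (G : Hypergraph α) : ℕ∞ :=
  ⨆ (k : ℕ) (_ : G.ShattersSize k), (k : ℕ∞)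

/-- The slicewise VC-dimension of `H`: the maximum of the VC-dimensions of its slice graphs. -/
noncomputable def slicewiseVCDim (H : Hypergraph α) : ℕ∞ :=
  ⨆ x ∈ V(H), (H.sliceGraph x).vcDim

/-- `d ∈ [0, ε) ∪ (1 - ε, 1]`. -/
def NearZeroOne (ε d : ℝ) : Prop :=
  d ∈ Set.Ico 0 ε ∪ Set.Ioc (1 - ε) 1

open Classical in
/-- The density of the triple `(X, Y, Z)` in the `3`-graph `H`: the proportion of
`(x, y, z) ∈ X × Y × Z` for which `{x, y, z}` is an edge. -/
noncomputable def density (H : Hypergraph α) (X Y Z : Finset α) : ℝ :=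
  (((X ×ˢ Y ×ˢ Z).filter fun p => ({p.1, p.2.1, p.2.2} : Set α) ∈ E(H)).card : ℝ) /
    ((X.card : ℝ) * (Y.card : ℝ) * (Z.card : ℝ))

/-- The triple `(X, Y, Z)` is `ε`-homogeneous with respect to `H`. -/
def IsHomogeneousTriple (H : Hypergraph α) (ε : ℝ) (X Y Z : Finset α) : Prop :=
  NearZeroOne ε (H.density X Y Z)

open Classical in
/-- The partition `P` of the (finite) vertex set `S` of the `3`-graph `H` is `ε`-homogeneous: at
least `(1 - ε)|S|³` of the ordered triples in `S³` lie in `X × Y × Z` for some `ε`-homogeneous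
triple `(X, Y, Z)` of parts. -/
def IsHomogeneousPartition [DecidableEq α] (H : Hypergraph α) (ε : ℝ) {S : Finset α}
    (P : Finpartition S) : Prop :=
  (1 - ε) * (S.card : ℝ) ^ 3 ≤
    (((S ×ˢ S ×ˢ S).filter fun p => ∃ X ∈ P.parts, ∃ Y ∈ P.parts, ∃ Z ∈ P.parts,
      H.IsHomogeneousTriple ε X Y Z ∧ p.1 ∈ X ∧ p.2.1 ∈ Y ∧ p.2.2 ∈ Z).card : ℝ)

open Classical in
/-- Let `A`, `B`, `C` be, in any order, the three parts of a tripartite `3`-graph `H`, and let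
`X ⊆ A`.  The set `X` is almost `ε`-good with respect to `H` if at least `(1 - ε)|B||C|` of the
pairs `(y, z) ∈ B × C` satisfy `|N_H(yz) ∩ X| / |X| ∈ [0, ε) ∪ (1 - ε, 1]`, where
`N_H(yz) = {x | {x, y, z} ∈ E(H)}`. -/
def IsAlmostGoodSet (H : Hypergraph α) (ε : ℝ) (B C X : Finset α) : Prop :=
  (1 - ε) * ((B.card : ℝ) * (C.card : ℝ)) ≤
    (((B ×ˢ C).filter fun p => NearZeroOne ε
      (((X.filter fun x => ({x, p.1, p.2} : Set α) ∈ E(H)).card : ℝ) / (X.card : ℝ))).card : ℝ)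

/-- Let `A`, `B`, `C` be, in any order, the three parts of a tripartite `3`-graph `H`.  A partition
`P` of `A` is almost `ε`-good with respect to `H` if there is a subcollection of parts that covers
at least `(1 - ε)|A|` vertices of `A` and all of whose members are almost `ε`-good sets. -/
def IsAlmostGoodPartition [DecidableEq α] (H : Hypergraph α) (ε : ℝ) (B C : Finset α)
    {A : Finset α} (P : Finpartition A) : Prop :=
  ∃ Q ⊆ P.parts, (1 - ε) * (A.card : ℝ) ≤ ((Q.biUnion id).card : ℝ) ∧
    ∀ X ∈ Q, H.IsAlmostGoodSet ε B C X

end Hypergraph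

/-!
Write `f u v w` for the edge relation on `U × V × W`. Colour `U`, separately for each `w`, by the
traces on `A ⊆ V` of the sets `{v | f u v w}`, and add a vertex `v` to `A` as long as these
colours do not determine `f u v w` up to few pairs `(u, w)`. Every addition increases the entropy
of the colourings by a fixed amount, whereas Sauer–Shelah bounds this entropy by `k log (|A| + 1)`
per pair; so a set `A` of polynomial size determines every `f u v w` up to few errors. These
colours still depend on `w`. Applying the same argument to the sets `{w | f u a w}`, for each fixed
`a ∈ A`, approximates `f u a w` through the values `f u a b` for polynomially many `b`, and now the
values of `f u a b` at all these pairs `(a, b)` induce a single partition of `U` into `2 ^ poly`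
parts. For almost all `(v, w)` and most of these parts `X`, the relation `f u v w` is nearly
constant in `u ∈ X`. Doing this for `U`, `V` and `W`, a triple of parts on which `f` is nearly
constant along most lines in all three directions is homogeneous, and Markov's inequality converts
average errors into proportions.
-/

namespace SliceRegularity

open Finset

section Disagreement

variable {β γ : Type*}

open Classical in
/-- The number of elements of `X` at which the predicates `p` and `q` differ: the pseudometric in
which all approximations below are measured. -/
noncomputable def disagreement (X : Finset β) (p q : β → Prop) : ℕ :=
  #{x ∈ X | ¬(p x ↔ q x)}

/-- The size of the smaller of `{x ∈ X | p x}` and `{x ∈ X | ¬ p x}`, expressed as the distance of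
`p` from the constant predicates. -/
noncomputable def minority (X : Finset β) (p : β → Prop) : ℕ :=
  min (disagreement X p fun _ => True) (disagreement X p fun _ => False)

theorem disagreement_le_card (X : Finset β) (p q : β → Prop) : disagreement X p q ≤ #X := by
  classical exact card_filter_le _ _

theorem disagreement_comm (X : Finset β) (p q : β → Prop) :
    disagreement X p q = disagreement X q p := by
  classical exact congrArg card (filter_congr fun x _ => not_congr iff_comm)

theorem disagreement_congr_right {X : Finset β} {p q r : β → Prop} (h : ∀ x ∈ X, q x ↔ r x) :
    disagreement X p q = disagreement X p r := by
  classical exact congrArg card (filter_congr fun x hx => by rw [h x hx])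

theorem disagreement_triangle (X : Finset β) (p q r : β → Prop) :
    disagreement X p r ≤ disagreement X p q + disagreement X q r := by
  classical
  refine (card_le_card fun x hx => ?_).trans (card_union_le _ _)
  simp only [mem_union, mem_filter] at hx ⊢
  tauto

theorem disagreement_product (X : Finset β) (Y : Finset γ) (p q : β × γ → Prop) :
    disagreement (X ×ˢ Y) p q = ∑ x ∈ X, disagreement Y (fun y => p (x, y)) fun y => q (x, y) := by
  simp only [disagreement, card_filter, sum_product]

theorem disagreement_product_right (X : Finset β) (Y : Finset γ) (p q : β × γ → Prop) :
    disagreement (X ×ˢ Y) p q = ∑ y ∈ Y, disagreement X (fun x => p (x, y)) fun x => q (x, y) := by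
  simp only [disagreement, card_filter, sum_product_right]

open Classical in
theorem disagreement_comp_filter_le (U : Finset β) (A : Finset γ) (p : β → Prop)
    (F G : γ → β → Prop) (g : Finset γ → Prop) :
    disagreement U p (fun u => g {a ∈ A | G a u}) ≤
      disagreement U p (fun u => g {a ∈ A | F a u}) + ∑ a ∈ A, disagreement U (F a) (G a) := by
  refine (disagreement_triangle U p (fun u => g {a ∈ A | F a u}) _).trans
    (Nat.add_le_add_left ((card_le_card fun u hu => ?_).trans card_biUnion_le) _)
  rw [mem_filter] at hu
  by_contra hagree
  simp only [mem_biUnion, mem_filter, not_exists, not_and, not_not] at hagree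
  exact hu.2 (iff_of_eq (congrArg g (filter_congr fun a ha => hagree a ha hu.1)))

theorem disagreement_true_add_disagreement_false (X : Finset β) (p : β → Prop) :
    disagreement X p (fun _ => True) + disagreement X p (fun _ => False) = #X := by
  classical
  rw [disagreement, disagreement, card_filter, card_filter, ← sum_add_distrib, card_eq_sum_ones]
  exact sum_congr rfl fun x _ => by by_cases hp : p x <;> simp [hp]

theorem minority_le_disagreement (X : Finset β) (p : β → Prop) (b : Prop) :
    minority X p ≤ disagreement X p fun _ => b := by
  by_cases hb : b
  · simp only [hb, minority, min_le_left]
  · simp only [hb, minority, min_le_right]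

theorem exists_minority_eq_disagreement (X : Finset β) (p : β → Prop) :
    ∃ b : Prop, minority X p = disagreement X p fun _ => b := by
  rcases min_choice (disagreement X p fun _ => True) (disagreement X p fun _ => False) with h | h
  exacts [⟨True, h⟩, ⟨False, h⟩]

theorem two_mul_minority_le_card (X : Finset β) (p : β → Prop) : 2 * minority X p ≤ #X := by
  have := disagreement_true_add_disagreement_false X p
  rw [minority]
  omega

theorem minority_eq_zero {X : Finset β} {p : β → Prop} (h : ∀ x ∈ X, ¬ p x) :
    minority X p = 0 := by
  refine Nat.eq_zero_of_le_zero ((minority_le_disagreement X p False).trans_eq ?_)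
  simpa [disagreement] using h

/-- Replace `p` on each row `X × {y}` by its majority value `g y`. Each column `{x} × Y` then
compares `g` with a constant at the cost of its own minority. -/
theorem minority_product_le (X : Finset β) (Y : Finset γ) (p : β × γ → Prop) :
    minority (X ×ˢ Y) p ≤
      2 * ∑ y ∈ Y, minority X (fun x => p (x, y)) + ∑ x ∈ X, minority Y fun y => p (x, y) := by
  choose g hg using fun y => exists_minority_eq_disagreement X fun x => p (x, y)
  have hrows : disagreement (X ×ˢ Y) p (fun z => g z.2) =
      ∑ y ∈ Y, minority X fun x => p (x, y) := by
    simp only [hg, disagreement_product_right]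
  obtain ⟨b, hb⟩ := exists_minority_eq_disagreement Y g
  have hcolumn : ∀ x, minority Y g ≤
      minority Y (fun y => p (x, y)) + disagreement Y (fun y => p (x, y)) g := fun x => by
    obtain ⟨d, hd⟩ := exists_minority_eq_disagreement Y fun y => p (x, y)
    rw [hd, add_comm, disagreement_comm Y _ g]
    exact (minority_le_disagreement Y g d).trans (disagreement_triangle _ _ _ _)
  have hconst : disagreement (X ×ˢ Y) (fun z => g z.2) (fun _ => b) ≤
      ∑ x ∈ X, minority Y (fun y => p (x, y)) + disagreement (X ×ˢ Y) p fun z => g z.2 := by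
    rw [disagreement_product, disagreement_product, ← sum_add_distrib]
    exact sum_le_sum fun x _ => hb ▸ hcolumn x
  have := (minority_le_disagreement (X ×ˢ Y) p b).trans
    (disagreement_triangle _ p (fun z => g z.2) _)
  omega

end Disagreement

section Finpartition

variable {β : Type*} [DecidableEq β] {U : Finset β}

theorem sum_parts_sum {M : Type*} [AddCommMonoid M] (P : Finpartition U) (φ : β → M) :
    ∑ X ∈ P.parts, ∑ x ∈ X, φ x = ∑ x ∈ U, φ x := by
  conv_rhs => rw [← P.biUnion_parts]
  exact (sum_biUnion P.supIndep.pairwiseDisjoint).symm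

theorem sum_minority_le_disagreement (P : Finpartition U) {p q : β → Prop}
    (hq : ∀ X ∈ P.parts, ∀ x ∈ X, ∀ x' ∈ X, q x ↔ q x') :
    ∑ X ∈ P.parts, minority X p ≤ disagreement U p q := by
  classical
  calc ∑ X ∈ P.parts, minority X p ≤ ∑ X ∈ P.parts, disagreement X p q := by
        refine sum_le_sum fun X hX => ?_
        obtain ⟨x, hx⟩ := P.nonempty_of_mem_parts hX
        rw [disagreement_congr_right fun x' hx' => hq X hX x' hx' x hx]
        exact minority_le_disagreement X p (q x)
    _ = disagreement U p q := by
        simp only [disagreement, card_filter]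
        exact sum_parts_sum P _

theorem mem_iff_mem_of_mem_atomise {F : Finset (Finset β)} {X S : Finset β} {x x' : β}
    (hX : X ∈ (Finpartition.atomise U F).parts) (hx : x ∈ X) (hx' : x' ∈ X) (hS : S ∈ F) :
    x ∈ S ↔ x' ∈ S := by
  obtain ⟨-, Q, -, rfl⟩ := Finpartition.mem_atomise.1 hX
  exact ((mem_filter.1 hx).2 S hS).symm.trans ((mem_filter.1 hx').2 S hS)

/-- The partition of a disjoint union whose parts are those of the two given partitions. -/
def disjointUnion {A B : Finset β} (h : Disjoint A B) (P : Finpartition A) (Q : Finpartition B) :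
    Finpartition (A ∪ B) where
  parts := P.parts ∪ Q.parts
  supIndep := by
    refine Set.PairwiseDisjoint.supIndep ?_
    rw [coe_union, Set.pairwiseDisjoint_union]
    exact ⟨P.supIndep.pairwiseDisjoint, Q.supIndep.pairwiseDisjoint,
      fun X hX Y hY _ => h.mono (P.le hX) (Q.le hY)⟩
  sup_parts := by rw [sup_union, P.sup_parts, Q.sup_parts, sup_eq_union]
  bot_notMem := by simp [P.empty_notMem_parts, Q.empty_notMem_parts]

end Finpartition

section Entropy

variable {β κ κ' : Type*}

open Classical in
/-- The elements of `U` with the same colour as `u`. -/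
noncomputable def colorClass (U : Finset β) (c : β → κ) (u : β) : Finset β :=
  {u' ∈ U | c u' = c u}

/-- The Shannon entropy of the colour of a uniformly random element of `U`, multiplied by `|U|`. -/
noncomputable def colorEntropy (U : Finset β) (c : β → κ) : ℝ :=
  ∑ u ∈ U, (Real.log #U - Real.log #(colorClass U c u))

theorem card_colorClass_pos {U : Finset β} {u : β} (hu : u ∈ U) (c : β → κ) :
    0 < #(colorClass U c u) :=
  card_pos.2 ⟨u, by simp [colorClass, hu]⟩

theorem card_colorClass_le_card (U : Finset β) (c : β → κ) (u : β) : #(colorClass U c u) ≤ #U := by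
  classical exact card_filter_le _ _

theorem colorEntropy_nonneg (U : Finset β) (c : β → κ) : 0 ≤ colorEntropy U c := by
  refine sum_nonneg fun u hu => sub_nonneg.2 (Real.log_le_log ?_ ?_)
  · exact_mod_cast card_colorClass_pos hu c
  · exact_mod_cast card_colorClass_le_card U c u

theorem sum_inv_card_colorClass [DecidableEq κ] (U : Finset β) (c : β → κ) :
    ∑ u ∈ U, (#(colorClass U c u) : ℝ)⁻¹ = #(U.image c) := by
  classical
  rw [← sum_fiberwise_of_maps_to fun u hu => mem_image_of_mem c hu, cast_card]
  refine sum_congr rfl fun t ht => ?_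
  obtain ⟨u, hu, rfl⟩ := mem_image.1 ht
  have hfiber : {u' ∈ U | c u' = c u} = colorClass U c u := by
    rw [colorClass]
    congr
  have hclass : ∀ u' ∈ U.filter (c · = c u), colorClass U c u' = colorClass U c u := by
    intro u' hu'
    ext x
    simp only [colorClass, mem_filter, (mem_filter.1 hu').2]
  rw [sum_congr rfl fun u' hu' => by rw [hclass u' hu'], hfiber, sum_const, nsmul_eq_mul]
  exact mul_inv_cancel₀ (Nat.cast_ne_zero.2 (card_colorClass_pos hu c).ne')

theorem colorEntropy_le [DecidableEq κ] (U : Finset β) (c : β → κ) :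
    colorEntropy U c ≤ #U * Real.log #(U.image c) := by
  rcases U.eq_empty_or_nonempty with rfl | hU
  · simp [colorEntropy]
  have hn : (0 : ℝ) < #U := by exact_mod_cast hU.card_pos
  have hN : (0 : ℝ) < #(U.image c) := by exact_mod_cast (hU.image c).card_pos
  -- `log x ≤ x - 1` at `x = |U| / (N |class|)`
  have hterm : ∀ u ∈ U, Real.log #U - Real.log #(colorClass U c u) ≤
      Real.log #(U.image c) + (#U / #(U.image c) * (#(colorClass U c u) : ℝ)⁻¹ - 1) := by
    intro u hu
    have hclass : (0 : ℝ) < #(colorClass U c u) := by exact_mod_cast card_colorClass_pos hu c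
    have hlog := Real.log_le_sub_one_of_pos
      (show 0 < #U / #(U.image c) * (#(colorClass U c u) : ℝ)⁻¹ by positivity)
    rw [Real.log_mul (by positivity) (by positivity), Real.log_div hn.ne' hN.ne', Real.log_inv]
      at hlog
    linarith
  refine (sum_le_sum hterm).trans_eq ?_
  rw [sum_add_distrib, sum_sub_distrib, ← mul_sum, sum_inv_card_colorClass,
    div_mul_cancel₀ _ hN.ne']
  simp

/-- If `p` is far from every function of the colour `c`, then refining `c` by `p` gains entropy:
with `g` the majority vote in each colour class, every `u` where `p` and `g ∘ c` differ lands in a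
class of at most half the size. -/
theorem exists_disagreement_le_colorEntropy_sub {U : Finset β} {c : β → κ} {c' : β → κ'}
    {p : β → Prop} (h : ∀ u u', c' u' = c' u ↔ c u' = c u ∧ (p u' ↔ p u)) :
    ∃ g : κ → Prop, Real.log 2 * disagreement U p (fun u => g (c u)) ≤
      colorEntropy U c' - colorEntropy U c := by
  classical
  choose g hg using fun t => exists_minority_eq_disagreement {u ∈ U | c u = t} p
  refine ⟨g, ?_⟩
  have hrefine : ∀ u, colorClass U c' u = {u' ∈ colorClass U c u | p u' ↔ p u} := fun u => by
    simp only [colorClass, filter_filter, h]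
  have hhalf : ∀ u, ¬(p u ↔ g (c u)) → 2 * #(colorClass U c' u) ≤ #(colorClass U c u) := by
    intro u hu
    have hclass : #(colorClass U c' u) = minority (colorClass U c u) p := by
      rw [hrefine, colorClass, hg (c u), disagreement]
      exact congrArg card (filter_congr fun u' _ => by tauto)
    exact hclass ▸ two_mul_minority_le_card _ _
  rw [colorEntropy, colorEntropy, ← sum_sub_distrib, disagreement, card_filter, Nat.cast_sum,
    mul_sum]
  refine sum_le_sum fun u hu => ?_
  have hpos : (0 : ℝ) < #(colorClass U c' u) := by exact_mod_cast card_colorClass_pos hu c'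
  by_cases hagree : p u ↔ g (c u)
  · have hlog : Real.log #(colorClass U c' u) ≤ Real.log #(colorClass U c u) :=
      Real.log_le_log hpos (by exact_mod_cast hrefine u ▸ card_filter_le _ _)
    simp only [hagree, not_true_eq_false, if_false, Nat.cast_zero, mul_zero]
    linarith
  · have hlog : Real.log (2 * #(colorClass U c' u)) ≤ Real.log #(colorClass U c u) :=
      Real.log_le_log (by positivity) (by exact_mod_cast hhalf u hagree)
    rw [Real.log_mul two_ne_zero hpos.ne'] at hlog
    simp only [hagree, not_false_eq_true, if_true, Nat.cast_one, mul_one]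
    linarith

end Entropy

section Trace

variable {β γ δ : Type*} {f : β → γ → δ → Prop} {U : Finset β} {V : Finset γ} {W : Finset δ}
  {k : ℕ} {ε : ℝ}

open Classical in
/-- The trace on `A` of the set `{v | f u v w}`. -/
noncomputable def trace (f : β → γ → δ → Prop) (A : Finset γ) (w : δ) (u : β) : Finset γ :=
  {v ∈ A | f u v w}

open Classical in
/-- For each `w ∈ W`, the sets `{v | f u v w}` with `u ∈ U` have at most `(|A| + 1) ^ k` traces on
each `A ⊆ V`. By the Sauer–Shelah lemma, this is how a bounded VC-dimension is used. -/
def HasPolynomialTraces (f : β → γ → δ → Prop) (U : Finset β) (V : Finset γ) (W : Finset δ)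
    (k : ℕ) : Prop :=
  ∀ w ∈ W, ∀ A ⊆ V, #(U.image (trace f A w)) ≤ (#A + 1) ^ k

/-- The sum over `w ∈ W` of the entropies of the colourings of `U` by the traces on `A`. -/
noncomputable def traceEntropy (f : β → γ → δ → Prop) (U : Finset β) (W : Finset δ)
    (A : Finset γ) : ℝ :=
  ∑ w ∈ W, colorEntropy U (trace f A w)

/-- Up to at most `M` pairs `(u, w) ∈ U × W`, the truth value of `f u v w` is a function of `w` and
of the trace of `{v' | f u v' w}` on `A`. -/
def TraceDetermines (f : β → γ → δ → Prop) (U : Finset β) (W : Finset δ) (A : Finset γ) (M : ℝ)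
    (v : γ) : Prop :=
  ∃ g : δ → Finset γ → Prop,
    (∑ w ∈ W, disagreement U (fun u => f u v w) fun u => g w (trace f A w u) : ℕ) ≤ M

theorem trace_insert_eq_iff [DecidableEq γ] {A : Finset γ} {v : γ} {w : δ} {u u' : β} :
    trace f (insert v A) w u' = trace f (insert v A) w u ↔
      trace f A w u' = trace f A w u ∧ (f u' v w ↔ f u v w) := by
  simp only [trace, Finset.ext_iff, mem_filter, mem_insert, and_congr_right_iff,
    forall_eq_or_imp]
  exact and_comm

theorem traceEntropy_add_le_insert [DecidableEq γ] {A : Finset γ} {M : ℝ} {v : γ}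
    (hv : ¬ TraceDetermines f U W A M v) :
    traceEntropy f U W A + Real.log 2 * M ≤ traceEntropy f U W (insert v A) := by
  choose g hg using fun w => exists_disagreement_le_colorEntropy_sub (U := U)
    (p := fun u => f u v w) fun u u' => trace_insert_eq_iff (f := f) (A := A) (v := v) (w := w)
  have hM : M ≤ (∑ w ∈ W, disagreement U (fun u => f u v w) fun u => g w (trace f A w u) : ℕ) :=
    le_of_not_ge fun hle => hv ⟨g, hle⟩
  have hgain := sum_le_sum fun w (_ : w ∈ W) => hg w
  rw [← mul_sum, sum_sub_distrib, ← Nat.cast_sum] at hgain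
  have := mul_le_mul_of_nonneg_left hM (Real.log_nonneg one_le_two)
  simp only [traceEntropy]
  linarith

theorem exists_traceDetermines_or_le_traceEntropy (f : β → γ → δ → Prop) (U : Finset β)
    (V : Finset γ) (W : Finset δ) (M : ℝ) (N : ℕ) :
    (∃ A ⊆ V, #A ≤ N ∧ ∀ v ∈ V, TraceDetermines f U W A M v) ∨
      ∃ A ⊆ V, #A ≤ N ∧ N * (Real.log 2 * M) ≤ traceEntropy f U W A := by
  classical
  induction N with
  | zero =>
    exact Or.inr ⟨∅, empty_subset V, by simp, by
      rw [Nat.cast_zero, zero_mul]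
      exact sum_nonneg fun w _ => colorEntropy_nonneg U (trace f ∅ w)⟩
  | succ n ih =>
    rcases ih with ⟨A, hAV, hA, hdet⟩ | ⟨A, hAV, hA, hent⟩
    · exact Or.inl ⟨A, hAV, by omega, hdet⟩
    by_cases hdet : ∀ v ∈ V, TraceDetermines f U W A M v
    · exact Or.inl ⟨A, hAV, by omega, hdet⟩
    push Not at hdet
    obtain ⟨v, hv, hnot⟩ := hdet
    refine Or.inr ⟨insert v A, insert_subset hv hAV, (card_insert_le v A).trans (by omega), ?_⟩
    have := traceEntropy_add_le_insert hnot
    push_cast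
    linarith

theorem HasPolynomialTraces.traceEntropy_le (h : HasPolynomialTraces f U V W k) {A : Finset γ}
    (hA : A ⊆ V) : traceEntropy f U W A ≤ #U * #W * (k * Real.log (#A + 1)) := by
  classical
  rcases U.eq_empty_or_nonempty with rfl | hU
  · simp [traceEntropy, colorEntropy]
  have hterm : ∀ w ∈ W, colorEntropy U (trace f A w) ≤ #U * (k * Real.log (#A + 1)) := by
    intro w hw
    refine (colorEntropy_le U (trace f A w)).trans
      (mul_le_mul_of_nonneg_left ?_ (Nat.cast_nonneg #U))
    rw [← Real.log_pow]
    refine Real.log_le_log (by exact_mod_cast (hU.image _).card_pos) ?_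
    exact_mod_cast h w hw A hA
  refine (sum_le_card_nsmul W _ _ hterm).trans_eq ?_
  rw [nsmul_eq_mul]
  ring

theorem HasPolynomialTraces.exists_traceDetermines (h : HasPolynomialTraces f U V W k) {r : ℕ}
    (hr : 4 * k < r * ε) :
    ∃ A ⊆ V, #A ≤ r ^ 2 ∧ ∀ v ∈ V, TraceDetermines f U W A (ε * (#U * #W)) v := by
  rcases exists_traceDetermines_or_le_traceEntropy f U V W (ε * (#U * #W)) (r ^ 2) with
    hdet | ⟨A, hAV, hA, hent⟩
  · exact hdet
  have hlog : Real.log (#A + 1) ≤ 2 * r := by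
    have hsq : (#A : ℝ) + 1 ≤ (r + 1) ^ 2 := by
      have : (#A : ℝ) ≤ r ^ 2 := by exact_mod_cast hA
      nlinarith [(Nat.cast_nonneg r : (0 : ℝ) ≤ r)]
    calc Real.log (#A + 1) ≤ Real.log ((r + 1) ^ 2) := Real.log_le_log (by positivity) hsq
      _ = 2 * Real.log (r + 1) := by rw [Real.log_pow, Nat.cast_two]
      _ ≤ 2 * r := by
        linarith [Real.log_le_sub_one_of_pos (show (0 : ℝ) < r + 1 by positivity)]
  have hr₀ : (0 : ℝ) < r := by
    refine Nat.cast_pos.2 (Nat.pos_of_ne_zero ?_)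
    rintro rfl
    rw [Nat.cast_zero, zero_mul] at hr
    exact hr.not_ge (by positivity)
  have hempty : (#U * #W : ℝ) = 0 := by
    by_contra hne
    have : (0 : ℝ) < #U * #W := lt_of_le_of_ne (by positivity) (Ne.symm hne)
    have hupper : #U * #W * r * (r * ε * Real.log 2) ≤ #U * #W * r * (2 * k) :=
      calc #U * #W * r * (r * ε * Real.log 2)
          = (r ^ 2 : ℕ) * (Real.log 2 * (ε * (#U * #W))) := by push_cast; ring
        _ ≤ #U * #W * (k * Real.log (#A + 1)) := hent.trans (h.traceEntropy_le hAV)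
        _ ≤ #U * #W * (k * (2 * r)) := by gcongr
        _ = #U * #W * r * (2 * k) := by ring
    have := le_of_mul_le_mul_left hupper (by positivity)
    nlinarith [Real.log_two_gt_d9, (Nat.cast_nonneg k : (0 : ℝ) ≤ k)]
  refine ⟨A, hAV, hA, fun v _ => ⟨fun _ _ => True, ?_⟩⟩
  rw [hempty, mul_zero, ← hempty, mul_comm]
  exact_mod_cast sum_le_card_nsmul W _ _ fun w _ => disagreement_le_card U _ _

theorem HasPolynomialTraces.exists_disagreement_trace_le (h : HasPolynomialTraces f U V W k)
    {r : ℕ} (hr : 4 * k < r * ε) {w : δ} (hw : w ∈ W) :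
    ∃ A ⊆ V, #A ≤ r ^ 2 ∧ ∀ v ∈ V, ∃ g : Finset γ → Prop,
      (disagreement U (fun u => f u v w) fun u => g (trace f A w u)) ≤ ε * #U := by
  have hsingle : HasPolynomialTraces f U V {w} k := fun w' hw' =>
    h w' (mem_singleton.1 hw' ▸ hw)
  obtain ⟨A, hAV, hA, hdet⟩ := hsingle.exists_traceDetermines hr
  refine ⟨A, hAV, hA, fun v hv => ?_⟩
  obtain ⟨g, hg⟩ := hdet v hv
  exact ⟨g w, by simpa using hg⟩

/-- The trace of `{v | f u v w}` on `A` depends on `w`, but it consists of `|A|` truth values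
`f u a w`, each of which is in turn approximated by a function of the trace of `{w | f u a w}` on a
set `B a` not depending on `w`. -/
theorem HasPolynomialTraces.exists_pairs_approx (h : HasPolynomialTraces f U V W k)
    (h' : HasPolynomialTraces (fun u w v => f u v w) U W V k) {m : ℕ} (hm : 4 * k < m * ε) :
    ∃ Q : Finset (Σ _ : γ, δ), #Q ≤ m ^ 8 ∧ ∀ v ∈ V, ∃ q : δ → β → Prop,
      (∀ w u u', (∀ s ∈ Q, f u s.1 s.2 ↔ f u' s.1 s.2) → (q w u ↔ q w u')) ∧
        (∑ w ∈ W, disagreement U (fun u => f u v w) (q w) : ℕ) ≤ 2 * ε * (#U * #W) := by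
  classical
  have hmε : 0 < m * ε := lt_of_le_of_lt (by positivity) hm
  have hε : 0 < ε := pos_of_mul_pos_right hmε (Nat.cast_nonneg m)
  have hm₀ : (0 : ℝ) < m := pos_of_mul_pos_left hmε hε.le
  have hm' : 4 * k < (m ^ 3 : ℕ) * (ε / m ^ 2) := by
    rwa [Nat.cast_pow, show (m : ℝ) ^ 3 * (ε / m ^ 2) = m * ε by field_simp]
  obtain ⟨A, hAV, hA, hdet⟩ := h.exists_traceDetermines hm
  choose! B _ hB G hG using fun a (ha : a ∈ A) => h'.exists_disagreement_trace_le hm' (hAV ha)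
  refine ⟨A.sigma B, ?_, fun v hv => ?_⟩
  · calc #(A.sigma B) ≤ #A • (m ^ 3) ^ 2 := card_sigma A B ▸ sum_le_card_nsmul A _ _ hB
      _ ≤ m ^ 2 • (m ^ 3) ^ 2 := Nat.mul_le_mul_right _ hA
      _ = m ^ 8 := by rw [smul_eq_mul]; ring
  obtain ⟨g, hg⟩ := hdet v hv
  refine ⟨fun w u => g w {a ∈ A | G a w (trace (fun u w v => f u v w) (B a) a u)},
    fun w u u' hagree => ?_, ?_⟩
  · have htrace : ∀ a ∈ A, trace (fun u w v => f u v w) (B a) a u =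
        trace (fun u w v => f u v w) (B a) a u' := fun a ha =>
      filter_congr fun b hb => hagree ⟨a, b⟩ (mem_sigma.2 ⟨ha, hb⟩)
    exact iff_of_eq (congrArg (g w) (filter_congr fun a ha => by rw [htrace a ha]))
  have hreplace : ∀ w ∈ W, (∑ a ∈ A, disagreement U (fun u => f u a w)
      (fun u => G a w (trace (fun u w v => f u v w) (B a) a u)) : ℝ) ≤ ε * #U := by
    intro w hw
    calc _ ≤ #A • (ε / m ^ 2 * #U) := sum_le_card_nsmul A _ _ fun a ha => hG a ha w hw
      _ ≤ (m ^ 2 : ℕ) • (ε / m ^ 2 * #U) := nsmul_le_nsmul_left (by positivity) hA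
      _ = ε * #U := by rw [nsmul_eq_mul, Nat.cast_pow]; field_simp
  rw [Nat.cast_sum] at hg ⊢
  calc _ ≤ ∑ w ∈ W, ((disagreement U (fun u => f u v w) (fun u => g w (trace f A w u)) : ℝ) +
        ε * #U) := by
        refine sum_le_sum fun w hw => le_trans ?_ (add_le_add_right (hreplace w hw) _)
        exact_mod_cast disagreement_comp_filter_le U A _ (fun a u => f u a w) _ (g w)
    _ ≤ ε * (#U * #W) + #W • (ε * #U) := by
        rw [sum_add_distrib, sum_const]
        exact add_le_add_left hg _
    _ = 2 * ε * (#U * #W) := by rw [nsmul_eq_mul]; ring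

/-- The number of triples in `U × V × W` at which `f` differs from the best approximation that is
constant on the sets `X × {v} × {w}`, where `X` is a part of `P`. -/
noncomputable def partitionError [DecidableEq β] (f : β → γ → δ → Prop) (P : Finpartition U)
    (V : Finset γ) (W : Finset δ) : ℕ :=
  ∑ X ∈ P.parts, ∑ v ∈ V, ∑ w ∈ W, minority X fun x => f x v w

theorem HasPolynomialTraces.exists_partitionError_le [DecidableEq β]
    (h : HasPolynomialTraces f U V W k) (h' : HasPolynomialTraces (fun u w v => f u v w) U W V k)
    {m : ℕ} (hm : 8 * k < m * ε) :
    ∃ P : Finpartition U, #P.parts ≤ 2 ^ m ^ 8 ∧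
      (partitionError f P V W : ℝ) ≤ ε * (#U * #V * #W) := by
  classical
  obtain ⟨Q, hQ, happrox⟩ := h.exists_pairs_approx h' (ε := ε / 2) (m := m) (by linarith)
  let F : Finset (Finset β) := Q.image fun s => {u ∈ U | f u s.1 s.2}
  refine ⟨Finpartition.atomise U F, ?_, ?_⟩
  · exact Finpartition.card_atomise_le.trans
      (Nat.pow_le_pow_right two_pos (card_image_le.trans hQ))
  have hatom : ∀ X ∈ (Finpartition.atomise U F).parts, ∀ x ∈ X, ∀ x' ∈ X, ∀ s ∈ Q,
      f x s.1 s.2 ↔ f x' s.1 s.2 := by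
    intro X hX x hx x' hx' s hs
    have hXU := (Finpartition.atomise U F).le hX
    simpa [hXU hx, hXU hx'] using
      mem_iff_mem_of_mem_atomise hX hx hx' (mem_image_of_mem _ hs)
  have hslice : ∀ v ∈ V, (∑ X ∈ (Finpartition.atomise U F).parts, ∑ w ∈ W,
      minority X (fun x => f x v w) : ℕ) ≤ ε * (#U * #W) := by
    intro v hv
    obtain ⟨q, hq, herror⟩ := happrox v hv
    rw [mul_div_cancel₀ _ two_ne_zero] at herror
    refine le_trans (Nat.cast_le.2 ?_) herror
    rw [sum_comm]
    exact sum_le_sum fun w _ => sum_minority_le_disagreement _ fun X hX x hx x' hx' =>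
      hq w x x' (hatom X hX x hx x' hx')
  rw [partitionError, sum_comm, Nat.cast_sum]
  exact (sum_le_card_nsmul V _ _ hslice).trans_eq (by rw [nsmul_eq_mul]; ring)

end Trace

section SauerShelah

theorem sum_range_choose_le (n k : ℕ) : ∑ i ∈ range k, n.choose i ≤ (n + 1) ^ k :=
  calc ∑ i ∈ range k, n.choose i ≤ ∑ i ∈ range k, n ^ i * 1 ^ (k - i) * k.choose i := by
        refine sum_le_sum fun i hi => ?_
        rw [one_pow, mul_one]
        exact (Nat.choose_le_pow n i).trans
          (Nat.le_mul_of_pos_right _ (Nat.choose_pos (mem_range.1 hi).le))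
    _ ≤ ∑ i ∈ range (k + 1), n ^ i * 1 ^ (k - i) * k.choose i :=
        sum_le_sum_of_subset (range_subset_range.2 k.le_succ)
    _ = (n + 1) ^ k := (add_pow n 1 k).symm

theorem card_le_pow_of_not_shatters {β : Type*} [DecidableEq β] {k : ℕ} {A : Finset β}
    {𝒜 : Finset (Finset β)} (hA : ∀ s ∈ 𝒜, s ⊆ A)
    (h : ∀ s ⊆ A, #s = k → ¬ 𝒜.Shatters s) : #𝒜 ≤ (#A + 1) ^ k := by
  have hsmall : 𝒜.shatterer ⊆ (range k).biUnion fun i => A.powersetCard i := by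
    intro s hs
    rw [mem_shatterer] at hs
    obtain ⟨t, ht, hst⟩ := hs.exists_superset
    have hsA : s ⊆ A := hst.trans (hA t ht)
    have hcard : #s < k := by
      by_contra! hk
      obtain ⟨r, hrs, hr⟩ := exists_subset_card_eq hk
      exact h r (hrs.trans hsA) hr (hs.mono_right hrs)
    exact mem_biUnion.2 ⟨#s, mem_range.2 hcard, mem_powersetCard.2 ⟨hsA, rfl⟩⟩
  calc #𝒜 ≤ #𝒜.shatterer := card_le_card_shatterer 𝒜
    _ ≤ ∑ i ∈ range k, #(A.powersetCard i) := (card_le_card hsmall).trans card_biUnion_le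
    _ ≤ (#A + 1) ^ k := by simpa only [card_powersetCard] using sum_range_choose_le #A k

end SauerShelah

section SliceVCDim

variable {α : Type*} {H : Hypergraph α}

/-- The adjacency relation of a `3`-graph. -/
def IsEdge (H : Hypergraph α) (x y z : α) : Prop :=
  ({x, y, z} : Set α) ∈ E(H)

theorem isEdge_swap_right (x y z : α) : IsEdge H x y z ↔ IsEdge H x z y := by
  rw [IsEdge, IsEdge, Set.pair_comm]

theorem isEdge_swap_left (x y z : α) : IsEdge H x y z ↔ IsEdge H y x z := by
  rw [IsEdge, IsEdge, Set.insert_comm]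

theorem isEdge_rotate (x y z : α) : IsEdge H x y z ↔ IsEdge H z x y := by
  rw [isEdge_swap_right, isEdge_swap_left]

theorem le_slicewiseVCDim {k : ℕ} {w : α} (hw : w ∈ V(H))
    (h : (H.sliceGraph w).ShattersSize k) : (k : ℕ∞) ≤ H.slicewiseVCDim :=
  calc (k : ℕ∞) ≤ (H.sliceGraph w).vcDim :=
        le_iSup₂ (f := fun (k : ℕ) (_ : (H.sliceGraph w).ShattersSize k) => (k : ℕ∞)) k h
    _ ≤ H.slicewiseVCDim := le_iSup₂ (f := fun x (_ : x ∈ V(H)) => (H.sliceGraph x).vcDim) w hw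

theorem shattersSize_sliceGraph [DecidableEq α] {X Y s : Finset α} (hXY : Disjoint X Y)
    (hX : (X : Set α) ⊆ V(H)) (hY : (Y : Set α) ⊆ V(H)) (hs : s ⊆ Y) {w : α} {A : Finset α}
    (h : (X.image (trace (IsEdge H) A w)).Shatters s) (hsA : s ⊆ A) :
    (H.sliceGraph w).ShattersSize #s := by
  let e := s.equivFin.symm
  have hrealize : ∀ S : Finset (Fin #s), ∃ u ∈ X, ∀ i, IsEdge H u (e i) w ↔ i ∈ S := by
    intro S
    have hS : (S.image fun i => (e i : α)) ⊆ s := image_subset_iff.2 fun i _ => (e i).2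
    obtain ⟨t, ht, hst⟩ := h hS
    obtain ⟨u, hu, rfl⟩ := mem_image.1 ht
    refine ⟨u, hu, fun i => ?_⟩
    have := Finset.ext_iff.1 hst (e i)
    simpa [trace, hsA (e i).2, e.injective.eq_iff, Subtype.coe_inj] using this
  choose b hbX hb using hrealize
  have he : ∀ i, (e i : α) ∈ Y := fun i => hs (e i).2
  refine ⟨fun i => e i, b, fun i => hY (he i), fun S => hX (hbX S), fun i S => ?_⟩
  have hne : (e i : α) ≠ b S := fun h => disjoint_left.1 hXY (hbX S) (h ▸ he i)
  rw [← hb S i, isEdge_rotate, isEdge_swap_right]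
  exact ⟨fun h => h.2.2, fun h =>
    ⟨Set.pair_subset (hY (he i)) (hX (hbX S)), Set.encard_pair hne, h⟩⟩

theorem hasPolynomialTraces_isEdge {k : ℕ} (hk : H.slicewiseVCDim < (k : ℕ∞)) {X Y Z : Finset α}
    (hXY : Disjoint X Y) (hX : (X : Set α) ⊆ V(H)) (hY : (Y : Set α) ⊆ V(H))
    (hZ : (Z : Set α) ⊆ V(H)) : HasPolynomialTraces (IsEdge H) X Y Z k := by
  classical
  intro w hw A hA
  convert card_le_pow_of_not_shatters (𝒜 := X.image (trace (IsEdge H) A w)) (A := A) (k := k) ?_ ?_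
  · intro s hs
    obtain ⟨u, -, rfl⟩ := mem_image.1 hs
    exact filter_subset _ _
  · intro s hsA hs hshatters
    exact hk.not_ge (le_slicewiseVCDim (hZ hw)
      (hs ▸ shattersSize_sliceGraph hXY hX hY (hsA.trans hA) hshatters hsA))

end SliceVCDim

section Markov

theorem one_sub_mul_sum_le_sum_filter {ι : Type*} {s : Finset ι} {good : ι → Prop}
    [DecidablePred good] {μ φ : ι → ℝ} {c δ : ℝ} (hc : 0 < c) (hφ : ∀ i ∈ s, 0 ≤ φ i)
    (hbad : ∀ i ∈ s, ¬ good i → c * μ i ≤ φ i) (hsum : ∑ i ∈ s, φ i ≤ c * (δ * ∑ i ∈ s, μ i)) :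
    (1 - δ) * ∑ i ∈ s, μ i ≤ ∑ i ∈ s with good i, μ i := by
  have hle : c * ∑ i ∈ s with ¬ good i, μ i ≤ c * (δ * ∑ i ∈ s, μ i) :=
    calc c * ∑ i ∈ s with ¬ good i, μ i ≤ ∑ i ∈ s with ¬ good i, φ i := by
          rw [mul_sum]
          exact sum_le_sum fun i hi => hbad i (mem_filter.1 hi).1 (mem_filter.1 hi).2
      _ ≤ ∑ i ∈ s, φ i := sum_le_sum_of_subset_of_nonneg (filter_subset _ s) fun i hi _ => hφ i hi
      _ ≤ c * (δ * ∑ i ∈ s, μ i) := hsum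
  have hsplit := sum_filter_add_sum_filter_not s good μ
  linarith [le_of_mul_le_mul_left hle hc]

end Markov

section Homogeneity

variable {α : Type*} {H : Hypergraph α} {ε : ℝ}

open Classical in
theorem mul_card_le_minority {β : Type*} {X : Finset β} {p : β → Prop}
    (h : ¬ Hypergraph.NearZeroOne ε ((#{x ∈ X | p x} : ℝ) / #X)) : ε * #X ≤ minority X p := by
  rcases X.eq_empty_or_nonempty with rfl | hX
  · simp
  have hX' : (0 : ℝ) < #X := by exact_mod_cast hX.card_pos
  have htrue : disagreement X p (fun _ => False) = #{x ∈ X | p x} := by simp [disagreement]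
  have hsplit : (disagreement X p (fun _ => True) : ℝ) + #{x ∈ X | p x} = #X := by
    exact_mod_cast htrue ▸ disagreement_true_add_disagreement_false X p
  have hle : (#{x ∈ X | p x} : ℝ) / #X ≤ 1 :=
    div_le_one_of_le₀ (by exact_mod_cast card_filter_le X p) hX'.le
  simp only [Hypergraph.NearZeroOne, Set.mem_union, Set.mem_Ico, Set.mem_Ioc, not_or, not_and,
    not_lt] at h
  have hlow : ε ≤ (#{x ∈ X | p x} : ℝ) / #X := h.1 (by positivity)
  have hhigh : (#{x ∈ X | p x} : ℝ) / #X ≤ 1 - ε := le_of_not_gt fun hlt => h.2 hlt hle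
  rw [le_div_iff₀ hX'] at hlow
  rw [div_le_iff₀ hX'] at hhigh
  rw [minority, htrue, Nat.cast_min]
  exact le_min (by linarith) hlow

theorem isAlmostGoodSet_of_sum_minority_le (hε : 0 < ε) {B C X : Finset α} (hX : X.Nonempty)
    (h : (∑ y ∈ B, ∑ z ∈ C, minority X (fun x => IsEdge H x y z) : ℕ) ≤
      ε ^ 2 * (#B * #C) * #X) : H.IsAlmostGoodSet ε B C X := by
  classical
  have : (0 : ℝ) < #X := by exact_mod_cast hX.card_pos
  have hmarkov := one_sub_mul_sum_le_sum_filter (s := B ×ˢ C) (μ := fun _ => 1) (c := ε * #X)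
    (δ := ε) (φ := fun q => minority X fun x => IsEdge H x q.1 q.2)
    (good := fun q => Hypergraph.NearZeroOne ε ((#{x ∈ X | IsEdge H x q.1 q.2} : ℝ) / #X))
    (by positivity) (fun _ _ => Nat.cast_nonneg _)
    (fun q _ hq => (mul_one (ε * #X)).trans_le (mul_card_le_minority hq)) (by
      rw [← Nat.cast_sum, sum_product, sum_const, card_product, nsmul_one, Nat.cast_mul]
      linarith)
  simp only [sum_const, card_product, nsmul_one, Nat.cast_mul] at hmarkov
  exact hmarkov

theorem isAlmostGoodPartition_of_partitionError_le [DecidableEq α] (hε : 0 < ε)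
    {A B C : Finset α} {P : Finpartition A}
    (h : partitionError (IsEdge H) P B C ≤ ε ^ 3 * (#A * #B * #C)) :
    H.IsAlmostGoodPartition ε B C P := by
  classical
  rcases (by positivity : (0 : ℝ) ≤ #B * #C).eq_or_lt with hBC | hBC
  · refine ⟨P.parts, Subset.rfl, ?_, fun X _ => ?_⟩
    · rw [P.biUnion_parts]
      exact mul_le_of_le_one_left (Nat.cast_nonneg _) (by linarith)
    · rw [Hypergraph.IsAlmostGoodSet, ← hBC, mul_zero]
      exact Nat.cast_nonneg _
  refine ⟨{X ∈ P.parts | H.IsAlmostGoodSet ε B C X}, filter_subset _ _, ?_,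
    fun X hX => (mem_filter.1 hX).2⟩
  rw [card_biUnion fun X hX Y hY => P.disjoint (mem_filter.1 hX).1 (mem_filter.1 hY).1,
    ← P.sum_card_parts, Nat.cast_sum, Nat.cast_sum]
  refine one_sub_mul_sum_le_sum_filter (c := ε ^ 2 * (#B * #C))
    (φ := fun X => (∑ y ∈ B, ∑ z ∈ C, minority X fun x => IsEdge H x y z : ℕ))
    (by positivity) (fun _ _ => Nat.cast_nonneg _) (fun X hX hbad => ?_) ?_
  · exact le_of_not_ge fun hle =>
      hbad (isAlmostGoodSet_of_sum_minority_le hε (P.nonempty_of_mem_parts hX) hle)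
  · rw [← Nat.cast_sum, ← Nat.cast_sum, P.sum_card_parts]
    refine le_trans h (le_of_eq ?_)
    ring

theorem minority_box_le {β γ δ : Type*} (X : Finset β) (Y : Finset γ) (Z : Finset δ)
    (f : β → γ → δ → Prop) :
    minority (X ×ˢ Y ×ˢ Z) (fun t => f t.1 t.2.1 t.2.2) ≤
      2 * ∑ y ∈ Y, ∑ z ∈ Z, minority X (fun x => f x y z) +
        (2 * ∑ x ∈ X, ∑ z ∈ Z, minority Y (fun y => f x y z) +
          ∑ x ∈ X, ∑ y ∈ Y, minority Z fun z => f x y z) := by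
  refine (minority_product_le X (Y ×ˢ Z) _).trans ?_
  rw [sum_product, mul_sum _ _ 2, mul_sum X _ 2, ← sum_add_distrib]
  exact add_le_add le_rfl
    (sum_le_sum fun x _ => minority_product_le Y Z fun q => f x q.1 q.2)

theorem sum_minority_box_le [DecidableEq α] {S : Finset α} (P : Finpartition S) :
    ∑ q ∈ P.parts ×ˢ P.parts ×ˢ P.parts,
        minority (q.1 ×ˢ q.2.1 ×ˢ q.2.2) (fun t => IsEdge H t.1 t.2.1 t.2.2) ≤
      5 * partitionError (IsEdge H) P S S := by
  let T (X Y Z : Finset α) : ℕ := ∑ y ∈ Y, ∑ z ∈ Z, minority X fun x => IsEdge H x y z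
  have hbox : ∀ X Y Z : Finset α,
      minority (X ×ˢ Y ×ˢ Z) (fun t => IsEdge H t.1 t.2.1 t.2.2) ≤
        2 * T X Y Z + (2 * T Y X Z + T Z X Y) := fun X Y Z => by
    have hY : ∀ x z, minority Y (IsEdge H x · z) = minority Y (IsEdge H · x z) := fun x z => by
      simp only [isEdge_swap_left x]
    have hZ : ∀ x y, minority Z (IsEdge H x y ·) = minority Z (IsEdge H · x y) := fun x y => by
      simp only [isEdge_rotate x]
    exact (minority_box_le X Y Z (IsEdge H)).trans_eq (by simp only [T, hY, hZ])
  have hT : ∑ X ∈ P.parts, ∑ Y ∈ P.parts, ∑ Z ∈ P.parts, T X Y Z =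
      partitionError (IsEdge H) P S S := by
    refine sum_congr rfl fun X _ => ?_
    rw [← sum_parts_sum P]
    refine sum_congr rfl fun Y _ => ?_
    rw [sum_comm]
    exact sum_congr rfl fun y _ => sum_parts_sum P _
  have hT₂ : ∑ X ∈ P.parts, ∑ Y ∈ P.parts, ∑ Z ∈ P.parts, T Y X Z =
      partitionError (IsEdge H) P S S := by rw [sum_comm, hT]
  have hT₃ : ∑ X ∈ P.parts, ∑ Y ∈ P.parts, ∑ Z ∈ P.parts, T Z X Y =
      partitionError (IsEdge H) P S S := by
    rw [← hT₂]
    exact sum_congr rfl fun X _ => sum_comm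
  simp only [sum_product]
  refine (sum_le_sum fun X _ => sum_le_sum fun Y _ => sum_le_sum fun Z _ =>
    hbox X Y Z).trans_eq ?_
  simp only [sum_add_distrib, ← mul_sum, hT, hT₂, hT₃]
  ring

theorem pairwiseDisjoint_box [DecidableEq α] {S : Finset α} (P : Finpartition S) :
    Set.PairwiseDisjoint (SetLike.coe (P.parts ×ˢ P.parts ×ˢ P.parts))
      fun q => q.1 ×ˢ q.2.1 ×ˢ q.2.2 := by
  rintro ⟨X, Y, Z⟩ hq ⟨X', Y', Z'⟩ hq' hne
  simp only [coe_product, Set.mem_prod, mem_coe] at hq hq'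
  simp only [Function.onFun, disjoint_product]
  by_contra! hmeet
  obtain ⟨hX, hY, hZ⟩ := hmeet
  refine hne ?_
  rw [P.disjoint.eq hq.1 hq'.1 hX, P.disjoint.eq hq.2.1 hq'.2.1 hY,
    P.disjoint.eq hq.2.2 hq'.2.2 hZ]

theorem isHomogeneousPartition_of_partitionError_le [DecidableEq α] {τ : ℝ} (hτ : 0 < τ)
    {S : Finset α} {P : Finpartition S}
    (h : 5 * (partitionError (IsEdge H) P S S : ℝ) ≤ τ ^ 2 * #S ^ 3) :
    H.IsHomogeneousPartition τ P := by
  classical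
  let box (q : Finset α × Finset α × Finset α) : Finset (α × α × α) := q.1 ×ˢ q.2.1 ×ˢ q.2.2
  let good := {q ∈ P.parts ×ˢ P.parts ×ˢ P.parts | H.IsHomogeneousTriple τ q.1 q.2.1 q.2.2}
  have hmass : ∑ q ∈ P.parts ×ˢ P.parts ×ˢ P.parts, (#(box q) : ℝ) = #S ^ 3 := by
    simp only [box, card_product, Nat.cast_mul, sum_product, ← mul_sum, ← sum_mul, ← Nat.cast_sum,
      P.sum_card_parts]
    ring
  have hmarkov : (1 - τ) * #S ^ 3 ≤ ∑ q ∈ good, (#(box q) : ℝ) := by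
    rw [← hmass]
    refine one_sub_mul_sum_le_sum_filter (c := τ)
      (φ := fun q => minority (box q) fun t => IsEdge H t.1 t.2.1 t.2.2)
      hτ (fun _ _ => Nat.cast_nonneg _) (fun q _ hq => mul_card_le_minority ?_) ?_
    · have hcard : (#(box q) : ℝ) = #q.1 * #q.2.1 * #q.2.2 := by
        simp only [box, card_product, Nat.cast_mul, mul_assoc]
      rw [hcard]
      exact hq
    · rw [hmass]
      have : (∑ q ∈ P.parts ×ˢ P.parts ×ˢ P.parts,
          minority (box q) (fun t => IsEdge H t.1 t.2.1 t.2.2) : ℝ) ≤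
            5 * partitionError (IsEdge H) P S S := by exact_mod_cast sum_minority_box_le P
      linarith
  refine hmarkov.trans ?_
  rw [← Nat.cast_sum, ← card_biUnion fun q hq q' hq' =>
    pairwiseDisjoint_box P (filter_subset _ _ hq) (filter_subset _ _ hq')]
  refine Nat.cast_le.2 (card_le_card fun t ht => ?_)
  obtain ⟨q, hq, htq⟩ := mem_biUnion.1 ht
  simp only [mem_filter, mem_product] at hq
  simp only [mem_product] at htq
  simp only [mem_filter, mem_product]
  exact ⟨⟨P.le hq.1.1 htq.1, P.le hq.1.2.1 htq.2.1, P.le hq.1.2.2 htq.2.2⟩,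
    q.1, hq.1.1, q.2.1, hq.1.2.1, q.2.2, hq.1.2.2, hq.2, htq⟩

end Homogeneity

section Tripartite

variable {α : Type*} {H : Hypergraph α} {U V W : Finset α}

theorem isTripartite_swap_left (ht : H.IsTripartite U V W) : H.IsTripartite V U W where
  vertexSet_eq := by rw [ht.vertexSet_eq, Set.union_comm (U : Set α)]
  disjoint_left_mid := ht.disjoint_left_mid.symm
  disjoint_left_right := ht.disjoint_mid_right
  disjoint_mid_right := ht.disjoint_left_right
  encard_inter_left_le := ht.encard_inter_mid_le
  encard_inter_mid_le := ht.encard_inter_left_le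
  encard_inter_right_le := ht.encard_inter_right_le

theorem isTripartite_swap_right (ht : H.IsTripartite U V W) : H.IsTripartite U W V where
  vertexSet_eq := by rw [ht.vertexSet_eq, Set.union_right_comm]
  disjoint_left_mid := ht.disjoint_left_right
  disjoint_left_right := ht.disjoint_left_mid
  disjoint_mid_right := ht.disjoint_mid_right.symm
  encard_inter_left_le := ht.encard_inter_left_le
  encard_inter_mid_le := ht.encard_inter_right_le
  encard_inter_right_le := ht.encard_inter_mid_le

theorem not_isEdge_of_mem_of_mem (hu : H.IsUniform 3) {A : Finset α}
    (hA : ∀ e ∈ E(H), (e ∩ (A : Set α)).encard ≤ 1) {x y : α} (hx : x ∈ A) (hy : y ∈ A) (z : α) :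
    ¬ IsEdge H x y z := by
  intro h
  obtain rfl : x = y := Set.encard_le_one_iff.1 (hA _ h) x y (by simp [hx]) (by simp [hy])
  have hcard := hu _ h
  rw [Set.insert_eq_of_mem (Set.mem_insert x _)] at hcard
  have hpair : ({x, z} : Set α).encard ≤ 2 := by
    simpa only [Set.encard_singleton, one_add_one_eq_two] using Set.encard_insert_le {z} x
  exact absurd (hcard ▸ hpair) (by decide)

theorem mem_and_mem_of_isEdge [DecidableEq α] (hu : H.IsUniform 3) (ht : H.IsTripartite U V W)
    {x y z : α} (hx : x ∈ U) (hy : y ∈ U ∪ V ∪ W) (hz : z ∈ U ∪ V ∪ W) (h : IsEdge H x y z) :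
    y ∈ V ∧ z ∈ W ∨ y ∈ W ∧ z ∈ V := by
  have hyU : y ∉ U := fun hyU => not_isEdge_of_mem_of_mem hu ht.encard_inter_left_le hx hyU z h
  have hzU : z ∉ U := fun hzU => not_isEdge_of_mem_of_mem hu ht.encard_inter_left_le hx hzU y
    ((isEdge_swap_right x y z).1 h)
  have hyz : IsEdge H y z x := (isEdge_rotate y z x).2 h
  have hV : ¬ (y ∈ V ∧ z ∈ V) := fun hyzV =>
    not_isEdge_of_mem_of_mem hu ht.encard_inter_mid_le hyzV.1 hyzV.2 x hyz
  have hW : ¬ (y ∈ W ∧ z ∈ W) := fun hyzW =>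
    not_isEdge_of_mem_of_mem hu ht.encard_inter_right_le hyzW.1 hyzW.2 x hyz
  simp only [mem_union] at hy hz
  tauto

theorem partitionError_vertexSet_le [DecidableEq α] (hu : H.IsUniform 3)
    (ht : H.IsTripartite U V W) (P : Finpartition U) :
    partitionError (IsEdge H) P (U ∪ V ∪ W) (U ∪ V ∪ W) ≤
      2 * partitionError (IsEdge H) P V W := by
  classical
  rw [partitionError, partitionError, mul_sum]
  refine sum_le_sum fun X hX => ?_
  have hsupport : ∀ q ∈ (U ∪ V ∪ W) ×ˢ (U ∪ V ∪ W),
      minority X (fun x => IsEdge H x q.1 q.2) ≠ 0 → q ∈ V ×ˢ W ∪ W ×ˢ V := by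
    intro q hq hne
    by_contra hmem
    refine hne (minority_eq_zero fun x hx h => hmem ?_)
    simpa only [mem_union, mem_product] using
      mem_and_mem_of_isEdge hu ht (P.le hX hx) (mem_product.1 hq).1 (mem_product.1 hq).2 h
  have hsymm : ∑ q ∈ W ×ˢ V, minority X (fun x => IsEdge H x q.1 q.2) =
      ∑ q ∈ V ×ˢ W, minority X fun x => IsEdge H x q.1 q.2 := by
    rw [sum_product, sum_product_right]
    simp only [isEdge_swap_right]
  calc ∑ y ∈ U ∪ V ∪ W, ∑ z ∈ U ∪ V ∪ W, minority X (fun x => IsEdge H x y z)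
      = ∑ q ∈ (U ∪ V ∪ W) ×ˢ (U ∪ V ∪ W), minority X (fun x => IsEdge H x q.1 q.2) := by
        rw [sum_product]
    _ ≤ ∑ q ∈ V ×ˢ W ∪ W ×ˢ V, minority X (fun x => IsEdge H x q.1 q.2) :=
        sum_le_sum_of_ne_zero hsupport
    _ ≤ ∑ q ∈ V ×ˢ W, minority X (fun x => IsEdge H x q.1 q.2) +
          ∑ q ∈ W ×ˢ V, minority X (fun x => IsEdge H x q.1 q.2) :=
        Nat.le.intro sum_union_inter
    _ = 2 * ∑ y ∈ V, ∑ z ∈ W, minority X fun x => IsEdge H x y z := by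
        rw [hsymm, sum_product, two_mul]

theorem partitionError_disjointUnion_le {β γ δ : Type*} [DecidableEq β] (f : β → γ → δ → Prop)
    {A B : Finset β} (h : Disjoint A B) (P : Finpartition A) (Q : Finpartition B) (S : Finset γ)
    (T : Finset δ) : partitionError f (disjointUnion h P Q) S T ≤
      partitionError f P S T + partitionError f Q S T :=
  Nat.le.intro sum_union_inter

theorem exists_isAlmostGoodPartition [DecidableEq α] (hu : H.IsUniform 3)
    (ht : H.IsTripartite U V W) {k : ℕ} (hk : H.slicewiseVCDim < (k : ℕ∞)) {ε : ℝ} (hε : 0 < ε)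
    {m : ℕ} (hm : 8 * k < m * ε ^ 3) :
    ∃ P : Finpartition U, #P.parts ≤ 2 ^ m ^ 8 ∧ H.IsAlmostGoodPartition ε V W P ∧
      (partitionError (IsEdge H) P (U ∪ V ∪ W) (U ∪ V ∪ W) : ℝ) ≤ 2 * ε ^ 3 * #(U ∪ V ∪ W) ^ 3 := by
  have hUS : U ⊆ U ∪ V ∪ W := subset_union_left.trans subset_union_left
  have hVS : V ⊆ U ∪ V ∪ W := subset_union_right.trans subset_union_left
  have hWS : W ⊆ U ∪ V ∪ W := subset_union_right
  have hvertex : ∀ A ⊆ U ∪ V ∪ W, (A : Set α) ⊆ V(H) := fun A hA => by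
    rw [ht.vertexSet_eq]
    exact_mod_cast hA
  have hUVW := hasPolynomialTraces_isEdge hk ht.disjoint_left_mid (hvertex U hUS) (hvertex V hVS)
    (hvertex W hWS)
  have hUWV := hasPolynomialTraces_isEdge hk ht.disjoint_left_right (hvertex U hUS) (hvertex W hWS)
    (hvertex V hVS)
  obtain ⟨P, hcard, herror⟩ := hUVW.exists_partitionError_le
    (by simpa only [isEdge_swap_right] using hUWV) hm
  refine ⟨P, hcard, isAlmostGoodPartition_of_partitionError_le hε herror, ?_⟩
  calc (partitionError (IsEdge H) P (U ∪ V ∪ W) (U ∪ V ∪ W) : ℝ)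
      ≤ 2 * partitionError (IsEdge H) P V W := by
        exact_mod_cast partitionError_vertexSet_le hu ht P
    _ ≤ 2 * (ε ^ 3 * (#(U ∪ V ∪ W) * #(U ∪ V ∪ W) * #(U ∪ V ∪ W))) := by
        refine mul_le_mul_of_nonneg_left (herror.trans ?_) zero_le_two
        gcongr
    _ = 2 * ε ^ 3 * #(U ∪ V ∪ W) ^ 3 := by ring

theorem exists_isHomogeneousPartition [DecidableEq α] (hu : H.IsUniform 3)
    (ht : H.IsTripartite U V W) {k : ℕ} (hk : H.slicewiseVCDim < (k : ℕ∞)) {ε τ : ℝ} (hε : 0 < ε)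
    (hτ : 0 < τ) (hετ : 30 * ε ^ 3 ≤ τ ^ 2) {m : ℕ} (hm : 8 * k < m * ε ^ 3) :
    ∃ (P : Finpartition (U ∪ V ∪ W))
      (PU : Finpartition U) (PV : Finpartition V) (PW : Finpartition W),
      H.IsHomogeneousPartition τ P ∧ #P.parts ≤ 3 * 2 ^ m ^ 8 ∧
      P.parts = PU.parts ∪ PV.parts ∪ PW.parts ∧ H.IsAlmostGoodPartition ε V W PU ∧
      H.IsAlmostGoodPartition ε U W PV ∧ H.IsAlmostGoodPartition ε U V PW := by
  obtain ⟨PU, hcardU, hgoodU, herrorU⟩ := exists_isAlmostGoodPartition hu ht hk hε hm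
  obtain ⟨PV, hcardV, hgoodV, herrorV⟩ :=
    exists_isAlmostGoodPartition hu (isTripartite_swap_left ht) hk hε hm
  obtain ⟨PW, hcardW, hgoodW, herrorW⟩ := exists_isAlmostGoodPartition hu
    (isTripartite_swap_left (isTripartite_swap_right ht)) hk hε hm
  rw [union_comm V U] at herrorV
  rw [union_assoc W U V, union_comm W (U ∪ V)] at herrorW
  have hUVW : Disjoint (U ∪ V) W :=
    disjoint_union_left.2 ⟨ht.disjoint_left_right, ht.disjoint_mid_right⟩
  let PUV := disjointUnion ht.disjoint_left_mid PU PV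
  refine ⟨disjointUnion hUVW PUV PW, PU, PV, PW, isHomogeneousPartition_of_partitionError_le hτ ?_,
    ?_, rfl, hgoodU, hgoodV, hgoodW⟩
  · let error {A : Finset α} (P : Finpartition A) : ℕ :=
      partitionError (IsEdge H) P (U ∪ V ∪ W) (U ∪ V ∪ W)
    have hle : error (disjointUnion hUVW PUV PW) ≤ error PU + error PV + error PW :=
      (partitionError_disjointUnion_le _ _ _ _ _ _).trans
        (Nat.add_le_add_right (partitionError_disjointUnion_le _ _ _ _ _ _) _)
    calc 5 * (error (disjointUnion hUVW PUV PW) : ℝ) ≤ 5 * (error PU + error PV + error PW) :=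
          mul_le_mul_of_nonneg_left (by exact_mod_cast hle) (by norm_num)
      _ ≤ 30 * ε ^ 3 * #(U ∪ V ∪ W) ^ 3 := by linarith
      _ ≤ τ ^ 2 * #(U ∪ V ∪ W) ^ 3 := by gcongr
  · have hle : #(disjointUnion hUVW PUV PW).parts ≤ #PU.parts + #PV.parts + #PW.parts :=
      (card_union_le _ _).trans (Nat.add_le_add_right (card_union_le _ _) _)
    omega

end Tripartite

section Parameters

theorem three_mul_two_pow_le (n : ℕ) {y : ℝ} (hy : n + 1 ≤ y) :
    (3 * 2 ^ n : ℝ) ≤ 2 ^ (2 : ℝ) ^ y := by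
  have hexp : ((n + 2 : ℕ) : ℝ) ≤ 2 ^ y :=
    calc ((n + 2 : ℕ) : ℝ) ≤ 2 ^ (n + 1) := by exact_mod_cast Nat.lt_two_pow_self
      _ = (2 : ℝ) ^ ((n + 1 : ℕ) : ℝ) := (Real.rpow_natCast 2 (n + 1)).symm
      _ ≤ 2 ^ y := Real.rpow_le_rpow_of_exponent_le one_le_two (by exact_mod_cast hy)
  calc (3 * 2 ^ n : ℝ) ≤ 2 ^ (n + 2) := by
        rw [pow_add, mul_comm]
        gcongr
        norm_num
    _ = (2 : ℝ) ^ ((n + 2 : ℕ) : ℝ) := (Real.rpow_natCast 2 (n + 2)).symm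
    _ ≤ 2 ^ (2 : ℝ) ^ y := Real.rpow_le_rpow_of_exponent_le one_le_two hexp

theorem thirty_mul_pow_three_le_sq {τ : ℝ} (hτ : 0 ≤ τ) (hτ₁ : τ ≤ 1) :
    30 * (τ ^ 64 / 28) ^ 3 ≤ τ ^ 2 :=
  calc 30 * (τ ^ 64 / 28) ^ 3 = 30 / 21952 * τ ^ 192 := by ring
    _ ≤ 1 * τ ^ 192 := by gcongr; norm_num
    _ ≤ τ ^ 2 := (one_mul _).trans_le (pow_le_pow_of_le_one hτ hτ₁ (by norm_num))

theorem exists_parameter {k : ℕ} {τ : ℝ} (hτ : 0 < τ) (hτk : τ < 1 / (200000 * (k + 1))) :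
    ∃ m : ℕ, 8 * k < m * (τ ^ 64 / 28) ^ 3 ∧ 30 * (τ ^ 64 / 28) ^ 3 ≤ τ ^ 2 ∧
      (3 * 2 ^ m ^ 8 : ℝ) ≤ (2 : ℝ) ^ ((2 : ℝ) ^ (τ ^ (-1553 : ℝ))) := by
  have : (0 : ℝ) ≤ k := Nat.cast_nonneg k
  have hlarge : 200000 * ((k : ℝ) + 1) < τ⁻¹ := by
    rw [lt_inv_comm₀ (by positivity) hτ]
    simpa only [one_div] using hτk
  obtain ⟨x, rfl⟩ : ∃ x, τ = x⁻¹ := ⟨τ⁻¹, (inv_inv τ).symm⟩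
  rw [inv_inv] at hlarge
  have hx : 2 ≤ x := by linarith
  have hx₀ : 0 < x := by linarith
  have hpow : ∀ n : ℕ, 1 ≤ x ^ n := fun n => one_le_pow₀ (by linarith)
  -- `(τ ^ 64 / 28) ^ 3 = x⁻¹ ^ 192 / 21952`, and one further factor `x` absorbs `8 * k`
  refine ⟨⌈x ^ 193⌉₊, ?_,
    thirty_mul_pow_three_le_sq hτ.le (inv_le_one_of_one_le₀ (by linarith)), ?_⟩
  · calc 8 * (k : ℝ) < x / 21952 := by linarith
      _ = x ^ 193 * (x⁻¹ ^ 64 / 28) ^ 3 := by field_simp; norm_num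
      _ ≤ ⌈x ^ 193⌉₊ * (x⁻¹ ^ 64 / 28) ^ 3 := by
        gcongr
        exact Nat.le_ceil _
  have hceil : (⌈x ^ 193⌉₊ : ℝ) ≤ x ^ 194 :=
    calc (⌈x ^ 193⌉₊ : ℝ) ≤ x ^ 193 + 1 := (Nat.ceil_lt_add_one (by positivity)).le
      _ ≤ x ^ 193 * 2 := by linarith [hpow 193]
      _ ≤ x ^ 193 * x := by gcongr
      _ = x ^ 194 := (pow_succ x 193).symm
  have hexp : x⁻¹ ^ (-1553 : ℝ) = x ^ 1553 := by
    rw [Real.inv_rpow hx₀.le, Real.rpow_neg hx₀.le, inv_inv]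
    norm_cast
  rw [hexp]
  refine three_mul_two_pow_le _ ?_
  calc ((⌈x ^ 193⌉₊ ^ 8 : ℕ) : ℝ) + 1 ≤ (x ^ 194) ^ 8 + 1 := by
        rw [Nat.cast_pow]
        gcongr
    _ = x ^ 1552 + 1 := by rw [← pow_mul]
    _ ≤ x ^ 1552 * 2 := by linarith [hpow 1552]
    _ ≤ x ^ 1552 * x := by gcongr
    _ = x ^ 1553 := (pow_succ x 1552).symm

end Parameters

end SliceRegularity

theorem theorem4p1_general (k : ℕ) :
    ∃ K : ℝ, 0 < K ∧ ∃ ε₀ : ℝ, 0 < ε₀ ∧ ∀ τ : ℝ, 0 < τ → τ < ε₀ →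
      ∀ (α : Type*) [DecidableEq α] (H : Hypergraph α) (U V W : Finset α),
        H.IsUniform 3 → H.IsTripartite U V W → H.slicewiseVCDim < (k : ℕ∞) →
        ∃ (P : Finpartition (U ∪ V ∪ W))
          (PU : Finpartition U) (PV : Finpartition V) (PW : Finpartition W),
          H.IsHomogeneousPartition τ P ∧
          (P.parts.card : ℝ) ≤ (2 : ℝ) ^ ((2 : ℝ) ^ (τ ^ (-K))) ∧
          P.parts = PU.parts ∪ PV.parts ∪ PW.parts ∧
          H.IsAlmostGoodPartition (τ ^ 64 / 28) V W PU ∧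
          H.IsAlmostGoodPartition (τ ^ 64 / 28) U W PV ∧
          H.IsAlmostGoodPartition (τ ^ 64 / 28) U V PW := by
  refine ⟨1553, by norm_num, 1 / (200000 * (k + 1)), by positivity, ?_⟩
  intro τ hτ hτk α _ H U V W hu ht hk
  obtain ⟨m, hm, hετ, hsize⟩ := SliceRegularity.exists_parameter hτ hτk
  obtain ⟨P, PU, PV, PW, hP, hcard, hparts⟩ :=
    SliceRegularity.exists_isHomogeneousPartition hu ht hk (by positivity) hτ hετ hm
  exact ⟨P, PU, PV, PW, hP, le_trans (by exact_mod_cast hcard) hsize, hparts⟩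

theorem theorem4p1 :
    ∀ k : ℕ, 1 ≤ k → ∃ K : ℝ, 0 < K ∧ ∃ ε₀ : ℝ, 0 < ε₀ ∧ ∀ τ : ℝ, 0 < τ → τ < ε₀ →
      ∃ n₀ : ℕ, ∀ (α : Type*) [DecidableEq α] (H : Hypergraph α) (U V W : Finset α),
        H.IsUniform 3 → H.IsTripartite U V W → U.card = V.card → V.card = W.card →
        n₀ ≤ (U ∪ V ∪ W).card → H.slicewiseVCDim < (k : ℕ∞) →
        ∃ (P : Finpartition (U ∪ V ∪ W))
          (PU : Finpartition U) (PV : Finpartition V) (PW : Finpartition W),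
          H.IsHomogeneousPartition τ P ∧
          (P.parts.card : ℝ) ≤ (2 : ℝ) ^ ((2 : ℝ) ^ (τ ^ (-K))) ∧
          P.parts = PU.parts ∪ PV.parts ∪ PW.parts ∧
          H.IsAlmostGoodPartition (τ ^ 64 / 28) V W PU ∧
          H.IsAlmostGoodPartition (τ ^ 64 / 28) U W PV ∧
          H.IsAlmostGoodPartition (τ ^ 64 / 28) U V PW := by
  intro k _
  obtain ⟨K, hK, ε₀, hε₀, h⟩ := theorem4p1_general k
  exact ⟨K, hK, ε₀, hε₀, fun τ hτ hτε => ⟨0, fun α _ H U V W hu ht _ _ _ =>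
    h τ hτ hτε α H U V W hu ht⟩⟩
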